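/- **Setting.** Let $y_1,y_2,\dots$ be independent random variables with values in $[0,1]$. For some $\nu\in\{1,2,\dots\}\cup\{\infty\}$ the samples $y_k$ with $k\le\nu$ have law $\theta_0$ and mean $u_0$, and those with $k>\nu$ have law $\theta_1$ and mean $u_1$ ($\nu=\infty$: no change). Let $M\ge1$ be an integer with $M\le\nu$ (the first $M$ samples precede the change), let $\epsilon>0$, and assume $|u_0-u_1|\ge3\epsilon$ if $\nu<\infty$. Let $h>0$, $\hat u_0=\frac1M\sum_{k=1}^My_k$, and $$s_k^+=(y_k-\hat u_0-\epsilon)\mathbf 1_{\{k>M\}},\qquad s_k^-=(\hat u_0-y_k-\epsilon)\mathbf 1_{\{k>M\}} .$$ The tailored two-sided CUSUM starts from $g_0^\pm=0$, updates $g_k^\pm=\max(0,g_{k-1}^\pm+s_k^\pm)$, and raises an alarm at $k$ when $g_k^+\ge h$ or $g_k^-\ge h$. After an alarm both walks restart from $0$, with the same $\hat u_0$. Let * $D=\inf\{t\ge1:\text{alarm at }\nu+t\}$, the detection delay (for $\nu<\infty$); * $F$ be the number of false alarms in the $T$ slots after the first $M$, that is, of alarms at slots $k$ with $M<k\le M+T$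 and $k\le\nu$, where $T\in\{0,1,2,\dots\}$; * $H=\inf\{t\ge1:\text{alarm at }M+t\}$, the run length, and $L(\theta_0)=\mathbb E[H\mid\hat u_0]$ its conditional mean when $\nu=\infty$ (the mean time between false alarms). All three are counted without the first $M$ slots. Given $\hat u_0$, let $r^\pm(\theta_0)$ be the nonzero root $r$ of $\log\mathbb E_{\theta_0}[e^{rs^\pm_{M+1}}]$, the expectation being over $y_{M+1}\sim\theta_0$ with $\hat u_0$ held fixed; put $r^\pm(\theta_0)=+\infty$ if there is no nonzero root. Let $r(\theta_0)=\min(r^-(\theta_0),r^+(\theta_0))$. **Claim.** The following hold almost surely. 1. If $\nu<\infty$, then on $\{|\hat u_0-u_0|<\epsilon\}$ $$\mathbb E[D\mid\hat u_0]\le\frac{h+1}{|u_1-\hat u_0|-\epsilon}.$$ 2. On $\{|\hat u_0-u_0|<\epsilon\}$ $$\mathbb E[F\mid\hat u_0]\le\frac{2T}{\exp(r(\theta_0)h)},\qquad\text{and, if }\nu=\infty,\text{ also}\qquad \frac{T}{L(\theta_0)}\le\frac{2T}{\exp(r(\theta_0)h)}.$$ 3. If $\nu=\infty$, then on $\{|\hat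 u_0-u_0|>\epsilon\}$ the detector restarts after at most $\frac{h+1}{|\hat u_0-u_0|-\epsilon}$ slots in expectation, that is, $$\mathbb E[H\mid\hat u_0]\le\frac{h+1}{|\hat u_0-u_0|-\epsilon}.$$ (Expectations take values in $[0,\infty]$, with $c/\infty=0$ for finite $c\ge 0$.) -/

import Mathlib

open MeasureTheory ProbabilityTheory

namespace TailoredCUSUM

noncomputable section

/-! Samples are numbered `1, 2, …`: a sample path is a function `x : ℕ → ℝ` whose value at `0` is
never used. -/

/-- The estimate `û₀` of the pre-change mean: the average of the first `M` samples. -/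
def uHat (M : ℕ) (x : ℕ → ℝ) : ℝ :=
  (∑ k ∈ Finset.Icc 1 M, x k) / M

/-- The step `s_k⁺ = (y_k - û₀ - ε) 1{k > M}` of the upper random walk. -/
def stepUp (M : ℕ) (ε : ℝ) (x : ℕ → ℝ) (k : ℕ) : ℝ :=
  if M < k then x k - uHat M x - ε else 0

/-- The step `s_k⁻ = (û₀ - y_k - ε) 1{k > M}` of the lower random walk. -/
def stepLo (M : ℕ) (ε : ℝ) (x : ℕ → ℝ) (k : ℕ) : ℝ :=
  if M < k then uHat M x - x k - ε else 0

/-- One update `g ↦ max (0, g + s)` of both walks with the `k`-th sample. -/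
def update (M : ℕ) (ε : ℝ) (x : ℕ → ℝ) (k : ℕ) (g : ℝ × ℝ) : ℝ × ℝ :=
  (max 0 (g.1 + stepUp M ε x k), max 0 (g.2 + stepLo M ε x k))

/-- The alarm condition: `g⁺ ≥ h` or `g⁻ ≥ h`. -/
def Crosses (h : ℝ) (g : ℝ × ℝ) : Prop :=
  h ≤ g.1 ∨ h ≤ g.2

open Classical in
/-- State of the detector once the `k`-th sample has been processed. Both walks start from `0`, and
they restart from `0` after an alarm. Up to the first alarm this is the plain recursion
`g_k = max (0, g_{k-1} + s_k)`. -/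
def state (M : ℕ) (ε h : ℝ) (x : ℕ → ℝ) : ℕ → ℝ × ℝ
  | 0 => (0, 0)
  | k + 1 =>
    if Crosses h (update M ε x (k + 1) (state M ε h x k)) then (0, 0)
    else update M ε x (k + 1) (state M ε h x k)

/-- An alarm is raised at the `k`-th sample (`k ≥ 1`). -/
def Alarm (M : ℕ) (ε h : ℝ) (x : ℕ → ℝ) (k : ℕ) : Prop :=
  1 ≤ k ∧ Crosses h (update M ε x k (state M ε h x (k - 1)))

/-- The waiting time after the `n`-th sample until the next alarm, `inf {t ≥ 1 : alarm at n + t}`,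
which is `∞` if there is none. If the change occurs right after sample `n`, this is the detection
delay. -/
def delay (M : ℕ) (ε h : ℝ) (x : ℕ → ℝ) (n : ℕ) : ℕ∞ :=
  ⨅ (t : ℕ) (_ : 1 ≤ t ∧ Alarm M ε h x (n + t)), (t : ℕ∞)

/-- The run length: the number of samples until the first alarm, not counting the `M` samples used
for the estimate (during which the walks stay at `0`). -/
def runLength (M : ℕ) (ε h : ℝ) (x : ℕ → ℝ) : ℕ∞ :=
  delay M ε h x M

open Classical in
/-- The number of false alarms within the `T` samples that follow the first `M`, when the change
occurs right after sample `ν` (`ν = ∞`: no change): alarms raised while the samples are still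
pre-change. -/
def falseAlarms (M : ℕ) (ε h : ℝ) (x : ℕ → ℝ) (ν : ℕ∞) (T : ℕ) : ℕ :=
  ((Finset.Icc (M + 1) (M + T)).filter fun k : ℕ => (k : ℕ∞) ≤ ν ∧ Alarm M ε h x k).card

/-- `r⁺(θ)` for the value `v` of the estimate: the nonzero root of the log-moment generating
function of the step `y - v - ε`, `y ∼ θ`. When that step has nonzero mean there is at most one
nonzero root; the value is `+∞` if there is none. -/
def rootUp (θ : Measure ℝ) (ε v : ℝ) : EReal :=
  sInf {s : EReal | ∃ r : ℝ, s = r ∧ r ≠ 0 ∧ cgf (fun y : ℝ => y - v - ε) θ r = 0}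

/-- `r⁻(θ)` for the value `v` of the estimate: the same for the step `v - y - ε`, `y ∼ θ`. -/
def rootLo (θ : Measure ℝ) (ε v : ℝ) : EReal :=
  sInf {s : EReal | ∃ r : ℝ, s = r ∧ r ≠ 0 ∧ cgf (fun y : ℝ => v - y - ε) θ r = 0}

/-- `r(θ) = min (r⁻(θ), r⁺(θ))`. -/
def root (θ : Measure ℝ) (ε v : ℝ) : EReal :=
  min (rootLo θ ε v) (rootUp θ ε v)

/-- Independent `[0,1]`-valued samples `y 1, y 2, …` with law `θ₀` up to and including sample `ν`
and law `θ₁` afterwards; `ν = ∞` means that there is no change. -/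
structure IsChangeModel {Ω : Type*} [MeasurableSpace Ω] (P : Measure Ω) (y : ℕ → Ω → ℝ)
    (θ₀ θ₁ : Measure ℝ) (ν : ℕ∞) : Prop where
  supp₀ : ∀ᵐ x ∂θ₀, x ∈ Set.Icc (0 : ℝ) 1
  supp₁ : ∀ᵐ x ∂θ₁, x ∈ Set.Icc (0 : ℝ) 1
  meas : ∀ k, 1 ≤ k → Measurable (y k)
  indep : iIndepFun (fun k : ℕ => y (k + 1)) P
  law_before : ∀ k : ℕ, 1 ≤ k → (k : ℕ∞) ≤ ν → P.map (y k) = θ₀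
  law_after : ∀ k : ℕ, 1 ≤ k → ν < (k : ℕ∞) → P.map (y k) = θ₁

/-- The sample path observed at `ω`. -/
def path {Ω : Type*} (y : ℕ → Ω → ℝ) (ω : Ω) : ℕ → ℝ := fun k => y k ω

/-- The random variable `û₀`. -/
def est {Ω : Type*} (M : ℕ) (y : ℕ → Ω → ℝ) (ω : Ω) : ℝ := uHat M (path y ω)

/-- Conditional expectation of a `[0,∞]`-valued random variable given `û₀`. -/
def expGivenEst {Ω : Type*} [MeasurableSpace Ω] (P : Measure Ω) (M : ℕ) (y : ℕ → Ω → ℝ)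
    (X : Ω → ENNReal) : Ω → ENNReal :=
  condLExp (MeasurableSpace.comap (est M y) inferInstance) P X

end

end TailoredCUSUM

namespace TailoredCUSUM

noncomputable section

/-! The estimate depends on the first `M` samples only, and afterwards the detector is driven by
that number and the later samples, which are independent of it. Conditioning therefore freezes the
estimate at a value `v` (`condLExp_of_indepFun`), and it remains to study a CUSUM with independent
steps.

Delay: one walk has positive drift `μ`, namely the distance from the mean to `v` minus `ε`. Until
the alarm this walk dominates the sum of its steps and stays below `h`, and the alarm step adds at
most `1`; Wald's argument gives `μ` times the expected wait at most `h + 1`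
(`lintegral_waitTime_le`).

False alarms: when `v` is within `ε` of the mean, both drifts are negative, and `E exp (q s) ≤ 1`
for `q` between `0` and the root. The tail bound `P (g ≥ a) ≤ exp (-q a)` then survives every
update, restarts included, so each slot alarms with probability at most `2 exp (-q h)`
(`measure_alarmAt_le`). Summing over slots bounds the false alarms; splitting at the last alarm
turns the same estimate into a lower bound for the mean run length (`inv_le_lintegral_waitTime`). -/

/-- One update of a pair of one-sided walks. -/
def push (g s : ℝ × ℝ) : ℝ × ℝ := (max 0 (g.1 + s.1), max 0 (g.2 + s.2))

open Classical in
/-- The two-sided CUSUM with restarts, driven by a sequence of pairs of steps. -/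
def cusum (h : ℝ) (σ : ℕ → ℝ × ℝ) : ℕ → ℝ × ℝ
  | 0 => (0, 0)
  | k + 1 =>
    if Crosses h (push (cusum h σ k) (σ k)) then (0, 0) else push (cusum h σ k) (σ k)

/-- The step with index `k` raises an alarm. -/
def AlarmAt (h : ℝ) (σ : ℕ → ℝ × ℝ) (k : ℕ) : Prop :=
  Crosses h (push (cusum h σ k) (σ k))

/-- No alarm is raised by the `t` steps with indices `n, …, n + t - 1`. -/
def Quiet (h : ℝ) (σ : ℕ → ℝ × ℝ) (n t : ℕ) : Prop :=
  ∀ j < t, ¬ AlarmAt h σ (n + j)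

open Classical in
/-- The number of steps, counted from index `n`, until the next alarm. -/
def waitTime (h : ℝ) (σ : ℕ → ℝ × ℝ) (n : ℕ) : ENNReal :=
  ∑' t, if Quiet h σ n t then 1 else 0

/-- The pairs of steps of the detector when the estimate is `v`. -/
def steps (ε v : ℝ) (z : ℕ → ℝ) (i : ℕ) : ℝ × ℝ := (z i - v - ε, v - z i - ε)

/-- The samples after the first `M`. -/
def tail (M : ℕ) (x : ℕ → ℝ) (i : ℕ) : ℝ := x (M + i + 1)

/-! ### Pathwise properties of the detector -/

section Path

variable {h ε : ℝ} {M : ℕ} {x : ℕ → ℝ} {σ : ℕ → ℝ × ℝ}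

lemma state_eq_zero (hh : 0 < h) : ∀ k ≤ M, state M ε h x k = (0, 0)
  | 0, _ => rfl
  | k + 1, hk => by
    have hs : ¬ M < k + 1 := by omega
    have hu : update M ε x (k + 1) (0, 0) = (0, 0) := by simp [update, stepUp, stepLo, hs]
    rw [state, state_eq_zero hh k (by omega), hu, ite_self]

lemma update_eq_push (k : ℕ) (g : ℝ × ℝ) :
    update M ε x (M + k + 1) g = push g (steps ε (uHat M x) (tail M x) k) := by
  have hs : M < M + k + 1 := by omega
  simp [update, push, stepUp, stepLo, hs, steps, tail]

lemma state_eq_cusum (hh : 0 < h) (k : ℕ) :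
    state M ε h x (M + k) = cusum h (steps ε (uHat M x) (tail M x)) k := by
  induction k with
  | zero => exact state_eq_zero hh M le_rfl
  | succ k ih =>
    rw [← add_assoc, state, cusum, ih, update_eq_push]

lemma alarm_iff (hh : 0 < h) (k : ℕ) :
    Alarm M ε h x (M + k + 1) ↔ AlarmAt h (steps ε (uHat M x) (tail M x)) k := by
  rw [Alarm, AlarmAt, Nat.add_sub_cancel, state_eq_cusum hh, update_eq_push]
  simp

lemma quiet_zero (n : ℕ) : Quiet h σ n 0 := by simp [Quiet]

lemma quiet_succ {n t : ℕ} : Quiet h σ n (t + 1) ↔ Quiet h σ n t ∧ ¬ AlarmAt h σ (n + t) := by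
  simp only [Quiet, Nat.lt_succ_iff_lt_or_eq]
  constructor
  · exact fun H => ⟨fun j hj => H j (Or.inl hj), H t (Or.inr rfl)⟩
  · rintro ⟨H, H'⟩ j (hj | rfl)
    exacts [H j hj, H']

lemma tsum_ite_lt (N : ℕ) : (∑' t : ℕ, if t < N then (1 : ENNReal) else 0) = N := by
  rw [tsum_eq_sum (s := Finset.range N) (by intro t ht; simpa using ht)]
  rw [Finset.sum_congr rfl (g := fun _ => 1) (by intro t ht; simpa using ht)]
  simp

/-- A wait exceeds `t` exactly when the first `t` steps are quiet, so counting quiet `t` gives the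
delay, including the value `∞`. -/
lemma delay_eq_waitTime (hh : 0 < h) (n : ℕ) :
    (delay M ε h x (M + n) : ENNReal)
      = waitTime h (steps ε (uHat M x) (tail M x)) n := by
  classical
  set σ := steps ε (uHat M x) (tail M x) with hσ
  -- Step index `i` belongs to sample `M + i + 1`, hence the shift by one.
  have key : ∀ t, Alarm M ε h x (M + n + (t + 1)) ↔ AlarmAt h σ (n + t) := by
    intro t
    rw [hσ, ← alarm_iff hh]
    ring_nf
  by_cases hex : ∃ t, AlarmAt h σ (n + t)
  · have hd : delay M ε h x (M + n) = ((Nat.find hex + 1 : ℕ) : ℕ∞) := by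
      apply le_antisymm
      · exact iInf₂_le (Nat.find hex + 1) ⟨by omega, (key _).2 (Nat.find_spec hex)⟩
      · refine le_iInf₂ ?_
        rintro t ⟨ht, ha⟩
        obtain ⟨s, rfl⟩ := Nat.exists_eq_add_of_le' ht
        have := Nat.find_min' hex ((key s).1 ha)
        exact_mod_cast Nat.succ_le_succ this
    rw [hd, waitTime]
    have hq : ∀ t, Quiet h σ n t ↔ t < Nat.find hex + 1 := by
      intro t
      constructor
      · intro H
        by_contra hlt
        exact H (Nat.find hex) (by omega) (Nat.find_spec hex)
      · intro H j hj
        exact Nat.find_min hex (by omega)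
    simp only [hq, tsum_ite_lt]
    simp
  · have hd : delay M ε h x (M + n) = ⊤ := by
      refine iInf₂_eq_top.2 ?_
      rintro t ⟨ht, ha⟩
      obtain ⟨s, rfl⟩ := Nat.exists_eq_add_of_le' ht
      exact absurd ⟨s, (key s).1 ha⟩ hex
    have hq : ∀ t, Quiet h σ n t := fun t j _ hj => hex ⟨j, hj⟩
    simp [hd, waitTime, hq]

open Classical in
lemma falseAlarms_eq_sum (hh : 0 < h) (ν : ℕ∞) (T : ℕ) :
    (falseAlarms M ε h x ν T : ENNReal) = ∑ k ∈ Finset.range T,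
      if ((M + k + 1 : ℕ) : ℕ∞) ≤ ν ∧ AlarmAt h (steps ε (uHat M x) (tail M x)) k
        then 1 else 0 := by
  rw [falseAlarms, Finset.card_filter, Nat.cast_sum]
  have : Finset.Icc (M + 1) (M + T) = (Finset.range T).map (addLeftEmbedding (M + 1)) := by
    ext k
    simp only [Finset.mem_Icc, Finset.mem_map, Finset.mem_range, addLeftEmbedding_apply]
    constructor
    · intro hk
      exact ⟨k - (M + 1), by omega, by omega⟩
    · rintro ⟨j, hj, rfl⟩
      omega
  rw [this, Finset.sum_map]
  refine Finset.sum_congr rfl fun k _ => ?_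
  simp only [addLeftEmbedding_apply, ← alarm_iff hh, Nat.add_right_comm M 1 k]
  push_cast
  rfl

lemma cusum_nonneg_lt (hh : 0 < h) (k : ℕ) :
    (0 ≤ (cusum h σ k).1 ∧ (cusum h σ k).1 < h) ∧
      (0 ≤ (cusum h σ k).2 ∧ (cusum h σ k).2 < h) := by
  cases k with
  | zero => simp [cusum, hh]
  | succ k =>
    rw [cusum]
    split_ifs with hc
    · simp [hh]
    · simp only [Crosses, not_or, not_le] at hc
      exact ⟨⟨by simp [push], hc.1⟩, ⟨by simp [push], hc.2⟩⟩

lemma cusum_succ_of_alarm {k : ℕ} (ha : AlarmAt h σ k) : cusum h σ (k + 1) = (0, 0) := by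
  exact if_pos ha

lemma cusum_succ_of_not_alarm {k : ℕ} (ha : ¬ AlarmAt h σ k) :
    cusum h σ (k + 1) = push (cusum h σ k) (σ k) := by
  exact if_neg ha

lemma cusum_add_of_restart {n : ℕ} (hn : cusum h σ n = (0, 0)) (k : ℕ) :
    cusum h σ (n + k) = cusum h (fun i => σ (n + i)) k := by
  induction k with
  | zero => exact hn
  | succ k ih => rw [← add_assoc, cusum, cusum, ih]

lemma quiet_of_restart {n : ℕ} (hn : cusum h σ n = (0, 0)) (t : ℕ) :
    Quiet h σ n t ↔ Quiet h (fun i => σ (n + i)) 0 t := by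
  simp only [Quiet, AlarmAt, cusum_add_of_restart hn, zero_add]

lemma crosses_swap (g : ℝ × ℝ) : Crosses h g.swap ↔ Crosses h g := or_comm

/-- By this symmetry, results on the upper walk also serve the lower one. -/
lemma cusum_swap (k : ℕ) : cusum h (fun i => (σ i).swap) k = (cusum h σ k).swap := by
  induction k with
  | zero => rfl
  | succ k ih =>
    have hp : push (cusum h σ k).swap (σ k).swap = (push (cusum h σ k) (σ k)).swap := rfl
    rw [cusum, cusum, ih, hp]
    by_cases hc : Crosses h (push (cusum h σ k) (σ k))
    · rw [if_pos hc, if_pos ((crosses_swap _).2 hc)]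
      rfl
    · rw [if_neg hc, if_neg (mt (crosses_swap _).1 hc)]

lemma alarmAt_swap (k : ℕ) : AlarmAt h (fun i => (σ i).swap) k ↔ AlarmAt h σ k := by
  rw [AlarmAt, AlarmAt, cusum_swap]
  exact crosses_swap (push (cusum h σ k) (σ k))

lemma waitTime_swap (n : ℕ) : waitTime h (fun i => (σ i).swap) n = waitTime h σ n := by
  refine tsum_congr fun t => ?_
  have hq : Quiet h (fun i => (σ i).swap) n t ↔ Quiet h σ n t := by
    simp only [Quiet, alarmAt_swap]
  by_cases hc : Quiet h σ n t
  · rw [if_pos hc, if_pos (hq.2 hc)]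
  · rw [if_neg hc, if_neg (mt hq.1 hc)]

open Classical in
/-- While there is no alarm, the upper walk dominates the sum of its steps. -/
lemma sum_quiet_le (hh : 0 < h) {n : ℕ} (hσ : ∀ i, n ≤ i → (σ i).1 ≤ 1) (m : ℕ) :
    ∑ t ∈ Finset.range m, (if Quiet h σ n t then (σ (n + t)).1 else 0) ≤ h + 1 := by
  -- The induction carries the domination by the walk while all is quiet. The last counted step
  -- starts from a value below `h` and adds at most `1`; after the alarm the sum is frozen.
  suffices H : (Quiet h σ n m → ∑ t ∈ Finset.range m,
        (if Quiet h σ n t then (σ (n + t)).1 else 0) ≤ (cusum h σ (n + m)).1) ∧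
      ∑ t ∈ Finset.range m, (if Quiet h σ n t then (σ (n + t)).1 else 0) ≤ h + 1 from H.2
  induction m with
  | zero =>
    refine ⟨fun _ => ?_, ?_⟩
    · simpa using (cusum_nonneg_lt hh n).1.1
    · simp; linarith
  | succ m ih =>
    rw [Finset.sum_range_succ]
    have h1 := (cusum_nonneg_lt (σ := σ) hh (n + m)).1.2
    have h2 := hσ (n + m) (by omega)
    constructor
    · intro hq
      rw [quiet_succ] at hq
      have h3 := ih.1 hq.1
      rw [← add_assoc, cusum_succ_of_not_alarm hq.2, if_pos hq.1]
      refine le_trans ?_ (le_max_right _ _)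
      linarith
    · by_cases hq : Quiet h σ n m
      · have h3 := ih.1 hq
        rw [if_pos hq]
        linarith
      · simpa [hq] using ih.2

/-- A restart can only lower the walk, so upper tail bounds may ignore restarts. -/
lemma fst_cusum_succ_le (k : ℕ) :
    (cusum h σ (k + 1)).1 ≤ max 0 ((cusum h σ k).1 + (σ k).1) := by
  rw [cusum]
  split_ifs with hc
  · exact le_max_left _ _
  · exact le_rfl

lemma AlarmAt.exists_le (hh : 0 < h) {k : ℕ} (ha : AlarmAt h σ k) :
    h ≤ (cusum h σ k).1 + (σ k).1 ∨ h ≤ (cusum h σ k).2 + (σ k).2 := by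
  rcases ha with ha | ha
  · exact Or.inl ((le_max_iff.1 ha).resolve_left (not_le.2 hh))
  · exact Or.inr ((le_max_iff.1 ha).resolve_left (not_le.2 hh))

lemma exists_last_alarm (σ : ℕ → ℝ × ℝ) (T : ℕ) :
    Quiet h σ 0 T ∨ ∃ k < T, AlarmAt h σ k ∧ Quiet h σ (k + 1) (T - 1 - k) := by
  induction T with
  | zero => exact Or.inl (quiet_zero 0)
  | succ T ih =>
    by_cases ha : AlarmAt h σ T
    · exact Or.inr ⟨T, by omega, ha, by simp [Quiet]⟩
    rcases ih with hq | ⟨k, hk, hak, hq⟩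
    · exact Or.inl (quiet_succ.2 ⟨hq, by simpa using ha⟩)
    · refine Or.inr ⟨k, by omega, hak, ?_⟩
      have : T + 1 - 1 - k = (T - 1 - k) + 1 := by omega
      rw [this]
      refine quiet_succ.2 ⟨hq, ?_⟩
      have : k + 1 + (T - 1 - k) = T := by omega
      rwa [this]

end Path

/-! ### Measurability -/

section Measurability

variable {α : Type*} [MeasurableSpace α] {h : ℝ} {σ : ℕ → α → ℝ × ℝ}

lemma measurableSet_crosses {g : α → ℝ × ℝ} (hg : Measurable g) :
    MeasurableSet {a | Crosses h (g a)} :=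
  (measurableSet_le measurable_const hg.fst).union (measurableSet_le measurable_const hg.snd)

lemma measurable_push {g s : α → ℝ × ℝ} (hg : Measurable g) (hs : Measurable s) :
    Measurable fun a => push (g a) (s a) := by
  unfold push
  fun_prop

lemma measurable_cusum {k : ℕ} (hσ : ∀ i < k, Measurable (σ i)) :
    Measurable fun a => cusum h (fun i => σ i a) k := by
  induction k with
  | zero => exact measurable_const
  | succ k ih =>
    have hp := measurable_push (ih fun i hi => hσ i (by omega)) (hσ k (by omega))
    exact Measurable.ite (measurableSet_crosses hp) measurable_const hp

lemma measurableSet_alarmAt {k : ℕ} (hσ : ∀ i < k + 1, Measurable (σ i)) :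
    MeasurableSet {a | AlarmAt h (fun i => σ i a) k} :=
  measurableSet_crosses
    (measurable_push (measurable_cusum fun i hi => hσ i (by omega)) (hσ k (by omega)))

lemma measurableSet_quiet {n t : ℕ} (hσ : ∀ i < n + t, Measurable (σ i)) :
    MeasurableSet {a | Quiet h (fun i => σ i a) n t} := by
  simp only [Quiet, Set.ofPred_forall]
  refine MeasurableSet.iInter fun j => MeasurableSet.iInter fun hj => ?_
  exact (measurableSet_alarmAt fun i hi => hσ i (by omega)).compl

lemma measurable_indicator_quiet {n t : ℕ} (hσ : ∀ i < n + t, Measurable (σ i)) :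
    Measurable ({a | Quiet h (fun i => σ i a) n t}.indicator (1 : α → ℝ)) :=
  measurable_one.indicator (measurableSet_quiet hσ)

lemma measurable_waitTime (hσ : ∀ i, Measurable (σ i)) (n : ℕ) :
    Measurable fun a => waitTime h (fun i => σ i a) n := by
  classical
  refine Measurable.tsum fun t => ?_
  exact Measurable.ite (measurableSet_quiet fun i _ => hσ i) measurable_const measurable_const

end Measurability

/-! ### Independence of past and future, and freezing -/

section Independence

variable {Ω E : Type*} [MeasurableSpace E] {ξ : ℕ → Ω → E}

/-- The σ-algebra generated by the variables with indices below `k`. -/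
abbrev past (ξ : ℕ → Ω → E) (k : ℕ) : MeasurableSpace Ω :=
  ⨆ i ∈ Set.Iio k, MeasurableSpace.comap (ξ i) inferInstance

/-- The σ-algebra generated by the variables with indices at least `k`. -/
abbrev future (ξ : ℕ → Ω → E) (k : ℕ) : MeasurableSpace Ω :=
  ⨆ i ∈ Set.Ici k, MeasurableSpace.comap (ξ i) inferInstance

lemma measurable_past {i k : ℕ} (hi : i < k) : Measurable[past ξ k] (ξ i) :=
  (comap_measurable (ξ i)).mono
    (le_iSup₂ (f := fun i (_ : i ∈ Set.Iio k) => MeasurableSpace.comap (ξ i) inferInstance)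
      i hi) le_rfl

lemma measurable_future {i k : ℕ} (hi : k ≤ i) : Measurable[future ξ k] (ξ i) :=
  (comap_measurable (ξ i)).mono
    (le_iSup₂ (f := fun i (_ : i ∈ Set.Ici k) => MeasurableSpace.comap (ξ i) inferInstance)
      i hi) le_rfl

variable [MeasurableSpace Ω] {P : Measure Ω}

lemma indep_past_future (hm : ∀ i, Measurable (ξ i)) (hi : iIndepFun ξ P) (k : ℕ) :
    Indep (past ξ k) (future ξ k) P :=
  indep_iSup_of_disjoint (fun i => (hm i).comap_le) hi.iIndep
    (Set.disjoint_left.2 fun _ h1 h2 => absurd (Set.mem_Iio.1 h1) (not_lt.2 h2))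

lemma indepFun_of_past_of_future {β γ : Type*} [MeasurableSpace β] [MeasurableSpace γ]
    (hm : ∀ i, Measurable (ξ i)) (hi : iIndepFun ξ P) {k : ℕ} {X : Ω → β} {Y : Ω → γ}
    (hX : Measurable[past ξ k] X) (hY : Measurable[future ξ k] Y) : IndepFun X Y P := by
  rw [IndepFun_iff_Indep]
  exact indep_of_indep_of_le_left
    (indep_of_indep_of_le_right (indep_past_future hm hi k) hY.comap_le) hX.comap_le

/-- Freezing: conditionally on a random variable independent of `Z`, functions of both are
integrated over the law of `Z`. -/
lemma condLExp_of_indepFun [IsProbabilityMeasure P] {β γ : Type*} [MeasurableSpace β]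
    [MeasurableSpace γ] {X : Ω → β} {Z : Ω → γ} (hX : Measurable X) (hZ : Measurable Z)
    (hXZ : IndepFun X Z P) {f : β × γ → ENNReal} (hf : Measurable f) :
    condLExp (MeasurableSpace.comap X inferInstance) P (fun ω => f (X ω, Z ω))
      =ᵐ[P] fun ω => ∫⁻ ω', f (X ω, Z ω') ∂P := by
  have hY : Measurable fun b => ∫⁻ ω', f (b, Z ω') ∂P :=
    Measurable.lintegral_prod_right' (f := fun p : β × Ω => f (p.1, Z p.2)) (by fun_prop)
  refine (ae_eq_condLExp hX.comap_le P _
    (hY.comp (comap_measurable X)) ?_).symm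
  rintro _ ⟨B, hB, rfl⟩
  have hmap := (indepFun_iff_map_prod_eq_prod_map_map hX.aemeasurable hZ.aemeasurable).1 hXZ
  have : IsProbabilityMeasure (P.map Z) := Measure.isProbabilityMeasure_map hZ.aemeasurable
  -- Absorbing the event `X ∈ B` into the integrand reduces the claim to Tonelli for the product
  -- law.
  have hind : Measurable ((B ×ˢ Set.univ).indicator f) := hf.indicator (hB.prod .univ)
  rw [← lintegral_indicator (hX hB), ← lintegral_indicator (hX hB)]
  calc ∫⁻ ω, (X ⁻¹' B).indicator (fun ω => ∫⁻ ω', f (X ω, Z ω') ∂P) ω ∂P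
      = ∫⁻ ω, ∫⁻ ω', (B ×ˢ Set.univ).indicator f (X ω, Z ω') ∂P ∂P := by
        refine lintegral_congr fun ω => ?_
        by_cases hω : X ω ∈ B
        · simp [Set.indicator, hω]
        · simp [Set.indicator, hω]
    _ = ∫⁻ b, ∫⁻ c, (B ×ˢ Set.univ).indicator f (b, c) ∂(P.map Z) ∂(P.map X) := by
        rw [lintegral_map hind.lintegral_prod_right' hX]
        refine lintegral_congr fun ω => ?_
        rw [lintegral_map (by fun_prop) hZ]
    _ = ∫⁻ p, (B ×ˢ Set.univ).indicator f p ∂((P.map X).prod (P.map Z)) :=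
        (lintegral_prod _ hind.aemeasurable).symm
    _ = ∫⁻ ω, (B ×ˢ Set.univ).indicator f (X ω, Z ω) ∂P := by
        rw [← hmap, lintegral_map hind (hX.prodMk hZ)]
    _ = ∫⁻ ω, (X ⁻¹' B).indicator (fun ω => f (X ω, Z ω)) ω ∂P := by
        refine lintegral_congr fun ω => ?_
        by_cases hω : X ω ∈ B <;> simp [Set.indicator, hω]

lemma map_shift_eq [IsProbabilityMeasure P] (hm : ∀ i, Measurable (ξ i)) (hi : iIndepFun ξ P)
    {μ : Measure E} (hμ : ∀ i, P.map (ξ i) = μ) (k : ℕ) :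
    P.map (fun ω i => ξ (k + i) ω) = P.map (fun ω i => ξ i ω) := by
  have hk : iIndepFun (fun i => ξ (k + i)) P := hi.precomp (add_right_injective k)
  rw [hk.map_fun_eq_infinitePi_map fun i => hm _, hi.map_fun_eq_infinitePi_map hm]
  simp only [hμ]

end Independence

/-! ### Stability of exponential tails -/

section Exponential

/-- Given `S = s`, the tail of `X` at `a - s` costs `exp (-(r * a)) * exp (r * s)`; integrating over
`s` leaves a factor at most `1`. -/
lemma measure_le_add_le_exp {Ω : Type*} [MeasurableSpace Ω] {P : Measure Ω}
    [IsProbabilityMeasure P] {X S : Ω → ℝ} (hX : Measurable X) (hS : Measurable S)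
    (hXS : IndepFun X S P) {r : ℝ}
    (htail : ∀ a, P {ω | a ≤ X ω} ≤ ENNReal.ofReal (Real.exp (-(r * a))))
    (hexp : ∫⁻ ω, ENNReal.ofReal (Real.exp (r * S ω)) ∂P ≤ 1) (a : ℝ) :
    P {ω | a ≤ X ω + S ω} ≤ ENNReal.ofReal (Real.exp (-(r * a))) := by
  have hmap := (indepFun_iff_map_prod_eq_prod_map_map hS.aemeasurable hX.aemeasurable).1 hXS.symm
  have : IsProbabilityMeasure (P.map X) := Measure.isProbabilityMeasure_map hX.aemeasurable
  have hA : MeasurableSet {p : ℝ × ℝ | a ≤ p.2 + p.1} :=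
    measurableSet_le measurable_const (by fun_prop)
  calc P {ω | a ≤ X ω + S ω}
      = P.map (fun ω => (S ω, X ω)) {p : ℝ × ℝ | a ≤ p.2 + p.1} := by
        rw [Measure.map_apply (by fun_prop) hA]; rfl
    _ = ∫⁻ s, P.map X (Prod.mk s ⁻¹' {p : ℝ × ℝ | a ≤ p.2 + p.1}) ∂(P.map S) := by
        rw [hmap, Measure.prod_apply hA]
    _ ≤ ∫⁻ s, ENNReal.ofReal (Real.exp (-(r * a))) * ENNReal.ofReal (Real.exp (r * s))
          ∂(P.map S) := by
        refine lintegral_mono fun s => ?_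
        have hs : Prod.mk s ⁻¹' {p : ℝ × ℝ | a ≤ p.2 + p.1} = Set.Ici (a - s) := by
          ext x; simp
        rw [hs, Measure.map_apply hX measurableSet_Ici,
          ← ENNReal.ofReal_mul (Real.exp_nonneg _), ← Real.exp_add]
        refine (htail (a - s)).trans (le_of_eq ?_)
        ring_nf
    _ = ENNReal.ofReal (Real.exp (-(r * a))) *
          ∫⁻ ω, ENNReal.ofReal (Real.exp (r * S ω)) ∂P := by
        rw [lintegral_const_mul _ (by fun_prop), lintegral_map (by fun_prop) hS]
    _ ≤ ENNReal.ofReal (Real.exp (-(r * a))) := mul_le_of_le_one_right' hexp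

end Exponential

/-! ### Alarm probabilities and waiting times -/

section Cusum

variable {Ω : Type*} [MeasurableSpace Ω] {P : Measure Ω}
  {ξ : ℕ → Ω → ℝ × ℝ} {h : ℝ}

lemma indepFun_cusum (hm : ∀ i, Measurable (ξ i)) (hi : iIndepFun ξ P) (k : ℕ) :
    IndepFun (fun ω => (cusum h (fun i => ξ i ω) k)) (ξ k) P :=
  indepFun_of_past_of_future hm hi
    (@measurable_cusum Ω (past ξ k) h ξ k fun _ hi => measurable_past hi) (measurable_future le_rfl)

lemma iIndepFun_swap (hi : iIndepFun ξ P) : iIndepFun (fun i ω => (ξ i ω).swap) P :=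
  hi.comp (fun _ => Prod.swap) fun _ => measurable_swap

lemma lintegral_waitTime (hm : ∀ i, Measurable (ξ i)) (n : ℕ) :
    ∫⁻ ω, waitTime h (fun i => ξ i ω) n ∂P = ∑' t, P {ω | Quiet h (fun i => ξ i ω) n t} := by
  classical
  unfold waitTime
  have hq : ∀ t, MeasurableSet {ω | Quiet h (fun i => ξ i ω) n t} :=
    fun t => measurableSet_quiet fun i _ => hm i
  rw [lintegral_tsum fun t => (Measurable.ite (hq t) measurable_const
    measurable_const).aemeasurable]
  refine tsum_congr fun t => ?_
  rw [← lintegral_indicator_one (hq t)]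
  rfl

variable [IsProbabilityMeasure P]

/-- Exponential tail of the upper walk. -/
lemma measure_le_fst_cusum (hm : ∀ i, Measurable (ξ i)) (hi : iIndepFun ξ P) {r : ℝ}
    (hr : 0 ≤ r) (k : ℕ)
    (hexp : ∀ i < k, ∫⁻ ω, ENNReal.ofReal (Real.exp (r * (ξ i ω).1)) ∂P ≤ 1) (a : ℝ) :
    P {ω | a ≤ (cusum h (fun i => ξ i ω) k).1} ≤ ENNReal.ofReal (Real.exp (-(r * a))) := by
  -- For `a ≤ 0` the bound is at least `1`; for `a > 0` the truncation at `0` plays no role.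
  rcases le_or_gt a 0 with ha | ha
  · refine prob_le_one.trans ?_
    rw [ENNReal.one_le_ofReal, Real.one_le_exp_iff]
    nlinarith
  induction k generalizing a with
  | zero =>
    have : {ω : Ω | a ≤ (cusum h (fun i => ξ i ω) 0).1} = ∅ := by
      ext ω; simp [cusum, ha]
    simp [this]
  | succ k ih =>
    refine le_trans (measure_mono fun ω hω => ?_)
      (measure_le_add_le_exp (measurable_cusum (h := h) fun i _ => hm i).fst (hm k).fst
        ((indepFun_cusum hm hi k).comp measurable_fst measurable_fst) (fun b => ?_)
        (hexp k (by omega)) a)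
    · exact (le_max_iff.1 (le_trans hω (fst_cusum_succ_le k))).resolve_left (not_le.2 ha)
    · rcases le_or_gt b 0 with hb | hb
      · refine prob_le_one.trans ?_
        rw [ENNReal.one_le_ofReal, Real.one_le_exp_iff]
        nlinarith
      · exact ih (fun i hi => hexp i (by omega)) b hb

/-- An alarm is seen only in the value before the reset, since `cusum` itself always stays below
`h`. -/
lemma measure_le_fst_cusum_add (hm : ∀ i, Measurable (ξ i)) (hi : iIndepFun ξ P) {r : ℝ}
    (hr : 0 ≤ r) (k : ℕ)
    (hexp : ∀ i ≤ k, ∫⁻ ω, ENNReal.ofReal (Real.exp (r * (ξ i ω).1)) ∂P ≤ 1) (a : ℝ) :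
    P {ω | a ≤ (cusum h (fun i => ξ i ω) k).1 + (ξ k ω).1}
      ≤ ENNReal.ofReal (Real.exp (-(r * a))) :=
  measure_le_add_le_exp (measurable_cusum (h := h) fun i _ => hm i).fst (hm k).fst
    ((indepFun_cusum hm hi k).comp measurable_fst measurable_fst)
    (measure_le_fst_cusum hm hi hr k fun i hi => hexp i hi.le) (hexp k le_rfl) a

lemma measure_alarmAt_le (hh : 0 < h) (hm : ∀ i, Measurable (ξ i)) (hi : iIndepFun ξ P) {r : ℝ}
    (hr : 0 ≤ r) (k : ℕ)
    (hexp₁ : ∀ i ≤ k, ∫⁻ ω, ENNReal.ofReal (Real.exp (r * (ξ i ω).1)) ∂P ≤ 1)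
    (hexp₂ : ∀ i ≤ k, ∫⁻ ω, ENNReal.ofReal (Real.exp (r * (ξ i ω).2)) ∂P ≤ 1) :
    P {ω | AlarmAt h (fun i => ξ i ω) k} ≤ 2 * ENNReal.ofReal (Real.exp (-(r * h))) := by
  have h1 := measure_le_fst_cusum_add (h := h) hm hi hr k hexp₁ h
  have h2 := measure_le_fst_cusum_add (h := h) (fun i => measurable_swap.comp (hm i)) (iIndepFun_swap hi) hr k
    hexp₂ h
  rw [two_mul]
  refine le_trans (measure_mono fun ω hω => ?_) ((measure_union_le _ _).trans (add_le_add h1 h2))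
  rcases AlarmAt.exists_le hh hω with hω | hω
  · exact Or.inl hω
  · refine Or.inr ?_
    simpa [cusum_swap (σ := fun i => ξ i ω)] using hω

/-- Wald's bound for the expected time until an alarm, when the upper walk has positive drift. -/
lemma lintegral_waitTime_le (hh : 0 < h) (hm : ∀ i, Measurable (ξ i)) (hi : iIndepFun ξ P)
    {n : ℕ} {μ : ℝ} (hμ : 0 < μ) (hle : ∀ i, n ≤ i → ∀ᵐ ω ∂P, (ξ i ω).1 ≤ 1)
    (hint : ∀ i, n ≤ i → Integrable (fun ω => (ξ i ω).1) P)
    (hmean : ∀ i, n ≤ i → ∫ ω, (ξ i ω).1 ∂P = μ) :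
    ∫⁻ ω, waitTime h (fun i => ξ i ω) n ∂P ≤ ENNReal.ofReal ((h + 1) / μ) := by
  classical
  rw [lintegral_waitTime hm, ENNReal.tsum_eq_iSup_nat]
  refine iSup_le fun m => ?_
  have hq : ∀ t, MeasurableSet {ω | Quiet h (fun i => ξ i ω) n t} :=
    fun t => measurableSet_quiet fun i _ => hm i
  let I : ℕ → Ω → ℝ := fun t => {ω | Quiet h (fun i => ξ i ω) n t}.indicator 1
  have hIm : ∀ t, Measurable (I t) := fun t => measurable_one.indicator (hq t)
  have hIb : ∀ t ω, ‖I t ω‖ ≤ 1 := fun t ω => by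
    by_cases hω : Quiet h (fun i => ξ i ω) n t <;> simp [I, hω]
  have hII : ∀ t, ∫ ω, I t ω ∂P = P.real {ω | Quiet h (fun i => ξ i ω) n t} :=
    fun t => integral_indicator_one (hq t)
  -- Quietness before step `n + t` is decided by earlier steps.
  have hind : ∀ t, IndepFun (I t) (fun ω => (ξ (n + t) ω).1) P := fun t =>
    indepFun_of_past_of_future hm hi (k := n + t)
      (@measurable_indicator_quiet Ω (past ξ (n + t)) h ξ n t fun _ hi => measurable_past hi)
      (measurable_fst.comp (measurable_future le_rfl))
  have hprod : ∀ t, ∫ ω, I t ω * (ξ (n + t) ω).1 ∂P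
      = P.real {ω | Quiet h (fun i => ξ i ω) n t} * μ := fun t => by
    rw [(hind t).integral_fun_mul_eq_mul_integral (hIm t).aestronglyMeasurable
      (hint _ (by omega)).aestronglyMeasurable, hII, hmean _ (by omega)]
  have hpint : ∀ t, Integrable (fun ω => I t ω * (ξ (n + t) ω).1) P := fun t =>
    (hint _ (by omega)).bdd_mul (hIm t).aestronglyMeasurable (ae_of_all _ (hIb t))
  have hpath : ∀ᵐ ω ∂P, ∑ t ∈ Finset.range m, I t ω * (ξ (n + t) ω).1 ≤ h + 1 := by
    have hall : ∀ᵐ ω ∂P, ∀ i, n ≤ i → (ξ i ω).1 ≤ 1 := by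
      rw [ae_all_iff]
      intro i
      by_cases hni : n ≤ i
      · filter_upwards [hle i hni] with ω hω _ using hω
      · exact ae_of_all _ fun _ H => absurd H hni
    filter_upwards [hall] with ω hω
    refine le_trans (le_of_eq ?_) (sum_quiet_le (σ := fun i => ξ i ω) hh hω m)
    refine Finset.sum_congr rfl fun t _ => ?_
    by_cases hω : Quiet h (fun i => ξ i ω) n t <;> simp [I, hω]
  have hsum : (∑ t ∈ Finset.range m, P.real {ω | Quiet h (fun i => ξ i ω) n t}) * μ ≤ h + 1 := by
    rw [Finset.sum_mul, ← Finset.sum_congr rfl fun t _ => hprod t,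
      ← integral_finsetSum _ fun t _ => hpint t]
    calc _ ≤ ∫ _, (h + 1) ∂P :=
          integral_mono_ae (integrable_finsetSum _ fun t _ => hpint t) (integrable_const _) hpath
      _ = h + 1 := by simp
  rw [← le_div_iff₀ hμ] at hsum
  refine le_trans (le_of_eq ?_) (ENNReal.ofReal_le_ofReal hsum)
  rw [ENNReal.ofReal_sum_of_nonneg fun _ _ => measureReal_nonneg]
  simp

/-- An alarm resets both walks, so what follows depends on later steps alone; these are independent
of the past and have the law of the original sequence. -/
lemma measure_alarmAt_quiet (hm : ∀ i, Measurable (ξ i)) (hi : iIndepFun ξ P)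
    {μ : Measure (ℝ × ℝ)} (hμ : ∀ i, P.map (ξ i) = μ) (k m : ℕ) :
    P {ω | AlarmAt h (fun i => ξ i ω) k ∧ Quiet h (fun i => ξ i ω) (k + 1) m}
      = P {ω | AlarmAt h (fun i => ξ i ω) k} * P {ω | Quiet h (fun i => ξ i ω) 0 m} := by
  have hset : {ω | AlarmAt h (fun i => ξ i ω) k ∧ Quiet h (fun i => ξ i ω) (k + 1) m}
      = {ω | AlarmAt h (fun i => ξ i ω) k} ∩ {ω | Quiet h (fun i => ξ (k + 1 + i) ω) 0 m} := by
    ext ω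
    refine and_congr_right fun ha => ?_
    exact quiet_of_restart (cusum_succ_of_alarm ha) m
  have hB : MeasurableSet {z : ℕ → ℝ × ℝ | Quiet h z 0 m} :=
    measurableSet_quiet (σ := fun i (z : ℕ → ℝ × ℝ) => z i) fun i _ => measurable_pi_apply i
  have hshift : P {ω | Quiet h (fun i => ξ (k + 1 + i) ω) 0 m}
      = P {ω | Quiet h (fun i => ξ i ω) 0 m} := by
    have : P.map (fun ω i => ξ (k + 1 + i) ω) {z : ℕ → ℝ × ℝ | Quiet h z 0 m}
        = P.map (fun ω i => ξ i ω) {z : ℕ → ℝ × ℝ | Quiet h z 0 m} := by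
      rw [map_shift_eq hm hi hμ]
    rwa [Measure.map_apply (measurable_pi_lambda _ fun i => hm _) hB,
      Measure.map_apply (measurable_pi_lambda _ fun i => hm _) hB] at this
  rw [hset, ← hshift]
  refine (Indep_iff _ _ _).1 (indep_past_future hm hi (k + 1)) _ _
    (@measurableSet_alarmAt Ω (past ξ (k + 1)) h ξ k fun _ hi => measurable_past hi)
    (@measurableSet_quiet Ω (future ξ (k + 1)) h (fun i => ξ (k + 1 + i)) 0 m
      fun _ _ => measurable_future (by omega))

/-- Renewal bound: if alarms have probability at most `p` at every step, then the mean time between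
alarms is at least `1 / p`. -/
lemma inv_le_lintegral_waitTime (hm : ∀ i, Measurable (ξ i)) (hi : iIndepFun ξ P)
    {μ : Measure (ℝ × ℝ)} (hμ : ∀ i, P.map (ξ i) = μ) {p : ENNReal}
    (hp : ∀ k, P {ω | AlarmAt h (fun i => ξ i ω) k} ≤ p) :
    p⁻¹ ≤ ∫⁻ ω, waitTime h (fun i => ξ i ω) 0 ∂P := by
  rw [lintegral_waitTime hm]
  set q : ℕ → ENNReal := fun t => P {ω | Quiet h (fun i => ξ i ω) 0 t} with hq
  by_cases htop : ∑' t, q t = ⊤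
  · rw [htop]; exact le_top
  -- Either the first `T` steps are quiet, or there is a last alarm `k < T` followed by `T - 1 - k`
  -- quiet steps.
  have hfin : ∀ T, 1 ≤ q T + p * ∑' t, q t := by
    intro T
    calc (1 : ENNReal) = P Set.univ := measure_univ.symm
      _ ≤ P ({ω | Quiet h (fun i => ξ i ω) 0 T} ∪ ⋃ k ∈ Finset.range T,
            {ω | AlarmAt h (fun i => ξ i ω) k ∧
              Quiet h (fun i => ξ i ω) (k + 1) (T - 1 - k)}) := by
          refine measure_mono fun ω _ => ?_
          rcases exists_last_alarm (h := h) (fun i => ξ i ω) T with H | ⟨k, hk, H⟩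
          · exact Or.inl H
          · exact Or.inr (Set.mem_biUnion (Finset.mem_range.2 hk) H)
      _ ≤ q T + ∑ k ∈ Finset.range T, p * q (T - 1 - k) := by
          refine (measure_union_le _ _).trans (add_le_add le_rfl ?_)
          refine (measure_biUnion_finset_le _ _).trans (Finset.sum_le_sum fun k _ => ?_)
          rw [measure_alarmAt_quiet hm hi hμ]
          exact mul_le_mul_left (hp k) _
      _ ≤ q T + p * ∑' t, q t := by
          rw [← Finset.mul_sum, Finset.sum_range_reflect]
          gcongr
          exact ENNReal.sum_le_tsum _
  -- Summability forces `q T → 0`, so the first term disappears in the limit.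
  have hlim := (ENNReal.tendsto_atTop_zero_of_tsum_ne_top htop).add_const (p * ∑' t, q t)
  have h1 : 1 ≤ p * ∑' t, q t := by
    simpa using ge_of_tendsto' hlim hfin
  rw [← one_div]
  exact ENNReal.div_le_of_le_mul (by rwa [mul_comm])

end Cusum

/-! ### The root of the log-moment generating function -/

section Root

open Filter Topology

/-- For a bounded variable with negative mean, the moment generating function is at most `1` up to
the nonzero root of its logarithm. -/
lemma mgf_le_one_of_le_sInf {α : Type*} [MeasurableSpace α] {θ : Measure α}
    [IsProbabilityMeasure θ] {f : α → ℝ} (hf : AEMeasurable f θ) {a b : ℝ}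
    (hb : ∀ᵐ x ∂θ, f x ∈ Set.Icc a b) (hneg : ∫ x, f x ∂θ < 0) {q : ℝ} (hq₀ : 0 ≤ q)
    (hq : (q : EReal) ≤ sInf {s : EReal | ∃ r : ℝ, s = r ∧ r ≠ 0 ∧ cgf f θ r = 0}) :
    mgf f θ q ≤ 1 := by
  -- The slope at `0` is the negative mean, so the function dips below `1` to the right of `0`.
  -- Exceeding `1` at `q` would force a crossing strictly between, a nonzero root below the infimum.
  by_contra! hlt
  have hexp : ∀ t, Integrable (fun x => Real.exp (t * f x)) θ :=
    fun t => integrable_exp_mul_of_mem_Icc hf hb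
  have hcont : Continuous (mgf f θ) := continuous_mgf hexp
  have hq₁ : 0 < q := hq₀.lt_of_ne (by rintro rfl; simp at hlt)
  have huniv : integrableExpSet f θ = Set.univ := Set.eq_univ_of_forall hexp
  have hder : HasDerivAt (mgf f θ) (∫ x, f x ∂θ) 0 := by
    simpa using hasDerivAt_mgf (X := f) (μ := θ) (t := 0) (by simp [huniv])
  have hslope : ∀ᶠ t in 𝓝[>] (0 : ℝ), slope (mgf f θ) 0 t < 0 :=
    ((hasDerivAt_iff_tendsto_slope.1 hder).mono_left
      (nhdsWithin_mono _ fun t ht => (Set.mem_Ioi.1 ht).ne')).eventually_lt_const hneg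
  obtain ⟨δ, hδ, hδ₀, hδq⟩ := (hslope.and (Ioo_mem_nhdsGT hq₁)).exists
  have hδ₁ : mgf f θ δ < 1 := by
    rw [slope_def_field, sub_zero, mgf_zero, div_neg_iff] at hδ
    rcases hδ with hδ | hδ <;> linarith
  obtain ⟨c, hc, hc₁⟩ := intermediate_value_Ioo hδq.le hcont.continuousOn ⟨hδ₁, hlt⟩
  have hle : (q : EReal) ≤ c :=
    hq.trans (sInf_le ⟨c, rfl, (hδ₀.trans hc.1).ne', by rw [cgf, hc₁, Real.log_one]⟩)
  exact absurd (EReal.coe_le_coe_iff.1 hle) (not_le.2 hc.2)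

/-- With `c = ⊤`, letting `q → ∞` gives `p = 0`; for `c` negative or `⊥` the right side is at least
`1`, so the sign of the root need not be discussed. -/
lemma le_two_div_exp {p : ENNReal} (hp : p ≤ 1) {h : ℝ} (hh : 0 < h) {c : EReal}
    (H : ∀ q : ℝ, 0 ≤ q → (q : EReal) ≤ c → p ≤ 2 * ENNReal.ofReal (Real.exp (-(q * h)))) :
    p ≤ 2 / EReal.exp (c * h) := by
  induction c with
  | bot => simp [EReal.bot_mul_coe_of_pos hh, ENNReal.div_zero]
  | top =>
    have h0 : Tendsto (fun q : ℝ => 2 * ENNReal.ofReal (Real.exp (-(q * h)))) atTop (𝓝 0) := by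
      have h1 : Tendsto (fun q : ℝ => Real.exp (-(q * h))) atTop (𝓝 0) :=
        Real.tendsto_exp_neg_atTop_nhds_zero.comp (tendsto_id.atTop_mul_const hh)
      simpa using ENNReal.Tendsto.const_mul (ENNReal.tendsto_ofReal h1)
        (Or.inr ENNReal.ofNat_ne_top)
    have := ge_of_tendsto h0 ((eventually_ge_atTop 0).mono fun q hq => H q hq le_top)
    simp [nonpos_iff_eq_zero.1 this]
  | coe r =>
    rw [← EReal.coe_mul, EReal.exp_coe]
    rcases le_or_gt 0 r with hr | hr
    · refine (H r hr le_rfl).trans (le_of_eq ?_)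
      rw [Real.exp_neg, ENNReal.ofReal_inv_of_pos (Real.exp_pos _), div_eq_mul_inv]
    · refine hp.trans ?_
      rw [ENNReal.le_div_iff_mul_le (Or.inl (by simp [Real.exp_pos])) (Or.inl (by simp)), one_mul]
      calc ENNReal.ofReal (Real.exp (r * h)) ≤ ENNReal.ofReal 1 :=
            ENNReal.ofReal_le_ofReal (Real.exp_le_one_iff.2 (by nlinarith))
        _ ≤ 2 := by simp

end Root

/-! ### Bounds for a frozen estimate -/

section Samples

variable {Ω : Type*} [MeasurableSpace Ω] {P : Measure Ω} {z : ℕ → Ω → ℝ} {ε h v : ℝ}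

lemma measurable_steps {α : Type*} [MeasurableSpace α] {V : α → ℝ} {x : ℕ → α → ℝ}
    (hV : Measurable V) {i : ℕ} (hx : Measurable (x i)) :
    Measurable fun a => steps ε (V a) (fun i => x i a) i := by
  unfold steps
  fun_prop

lemma iIndepFun_steps (hi : iIndepFun z P) :
    iIndepFun (fun i ω => steps ε v (fun i => z i ω) i) P :=
  hi.comp (fun _ x => (x - v - ε, v - x - ε)) fun _ => by fun_prop

lemma map_steps (hm : ∀ i, Measurable (z i)) {θ : Measure ℝ} {i : ℕ} (hθ : P.map (z i) = θ) :
    P.map (fun ω => steps ε v (fun i => z i ω) i)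
      = θ.map fun x => (x - v - ε, v - x - ε) := by
  rw [← hθ, Measure.map_map (by fun_prop) (hm i)]
  rfl

lemma lintegral_exp_le_one {θ : Measure ℝ} [IsProbabilityMeasure θ] {y : Ω → ℝ}
    (hy : Measurable y) (hθ : P.map y = θ) {f : ℝ → ℝ} (hf : Measurable f) {a b : ℝ}
    (hb : ∀ᵐ x ∂θ, f x ∈ Set.Icc a b) {q : ℝ} (hq : mgf f θ q ≤ 1) :
    ∫⁻ ω, ENNReal.ofReal (Real.exp (q * f (y ω))) ∂P ≤ 1 := by
  have hmap : ∫⁻ ω, ENNReal.ofReal (Real.exp (q * f (y ω))) ∂P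
      = ∫⁻ x, ENNReal.ofReal (Real.exp (q * f x)) ∂θ := by
    rw [← hθ, lintegral_map (by fun_prop) hy]
  rw [hmap, ← ofReal_integral_eq_lintegral_ofReal (integrable_exp_mul_of_mem_Icc hf.aemeasurable hb)
    (ae_of_all _ fun _ => (Real.exp_pos _).le)]
  exact ENNReal.ofReal_le_one.2 hq

lemma integrable_id_of_ae_mem_Icc {θ : Measure ℝ} [IsProbabilityMeasure θ]
    (hs : ∀ᵐ x ∂θ, x ∈ Set.Icc (0 : ℝ) 1) : Integrable (fun x => x) θ :=
  Integrable.of_mem_Icc 0 1 aemeasurable_id hs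

variable [IsProbabilityMeasure P]

lemma integral_sub_sub_const {f : Ω → ℝ} (hf : Integrable f P) (v ε : ℝ) :
    ∫ ω, (f ω - v - ε) ∂P = ∫ ω, f ω ∂P - v - ε := by
  have hv : Integrable (fun ω => f ω - v) P := hf.sub (integrable_const v)
  rw [integral_sub hv (integrable_const ε), integral_sub hf (integrable_const v)]
  simp

lemma integral_const_sub_sub {f : Ω → ℝ} (hf : Integrable f P) (v ε : ℝ) :
    ∫ ω, (v - f ω - ε) ∂P = v - ∫ ω, f ω ∂P - ε := by
  have hv : Integrable (fun ω => v - f ω) P := (integrable_const v).sub hf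
  rw [integral_sub hv (integrable_const ε), integral_sub (integrable_const v) hf]
  simp

lemma lintegral_waitTime_steps_le {θ : Measure ℝ} [IsProbabilityMeasure θ]
    (hs : ∀ᵐ x ∂θ, x ∈ Set.Icc (0 : ℝ) 1) (hm : ∀ i, Measurable (z i)) (hi : iIndepFun z P)
    {n : ℕ} (hθ : ∀ i, n ≤ i → P.map (z i) = θ) (hh : 0 < h) (hε : 0 < ε)
    (hv : v ∈ Set.Icc (0 : ℝ) 1) (hd : ε < |∫ x, x ∂θ - v|) :
    ∫⁻ ω, waitTime h (steps ε v fun i => z i ω) n ∂P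
      ≤ ENNReal.ofReal ((h + 1) / (|∫ x, x ∂θ - v| - ε)) := by
  have hint := integrable_id_of_ae_mem_Icc hs
  have hms : ∀ i, Measurable fun ω => steps ε v (fun i => z i ω) i :=
    fun i => measurable_steps measurable_const (hm i)
  have hz : ∀ i, n ≤ i → ∀ᵐ ω ∂P, z i ω ∈ Set.Icc (0 : ℝ) 1 := fun i hni =>
    ae_of_ae_map (hm i).aemeasurable (by rwa [hθ i hni])
  have hzint : ∀ i, n ≤ i → Integrable (z i) P := fun i hni => by
    rw [← hθ i hni] at hint
    exact hint.comp_measurable (hm i)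
  have hzmean : ∀ i, n ≤ i → ∫ ω, z i ω ∂P = ∫ x, x ∂θ := fun i hni => by
    rw [← hθ i hni, integral_map (hm i).aemeasurable (by fun_prop)]
  -- The sign tells which walk drifts upwards; steps are at most `1` because samples and `v` lie in
  -- `[0, 1]`.
  rcases le_total 0 (∫ x, x ∂θ - v) with hpos | hpos
  · rw [abs_of_nonneg hpos] at hd ⊢
    refine lintegral_waitTime_le hh hms (iIndepFun_steps hi) (by linarith) (fun i hni => ?_)
      (fun i hni => ?_) fun i hni => ?_
    · filter_upwards [hz i hni] with ω hω
      simp only [steps]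
      linarith [hω.2, hv.1]
    · exact ((hzint i hni).sub (integrable_const v)).sub (integrable_const ε)
    · rw [← hzmean i hni]
      exact integral_sub_sub_const (hzint i hni) v ε
  · rw [abs_of_nonpos hpos] at hd ⊢
    rw [lintegral_congr fun ω => (waitTime_swap (σ := steps ε v fun i => z i ω) n).symm]
    refine lintegral_waitTime_le hh (fun i => measurable_swap.comp (hms i))
      (iIndepFun_swap (iIndepFun_steps hi)) (by linarith) (fun i hni => ?_)
      (fun i hni => ?_) fun i hni => ?_
    · filter_upwards [hz i hni] with ω hω
      simp only [steps, Function.comp_apply, Prod.fst_swap]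
      linarith [hω.1, hv.2]
    · exact ((integrable_const v).sub (hzint i hni)).sub (integrable_const ε)
    · rw [neg_sub, ← hzmean i hni]
      exact integral_const_sub_sub (hzint i hni) v ε

lemma measure_alarmAt_steps_le {θ : Measure ℝ} [IsProbabilityMeasure θ]
    (hs : ∀ᵐ x ∂θ, x ∈ Set.Icc (0 : ℝ) 1) (hm : ∀ i, Measurable (z i)) (hi : iIndepFun z P)
    {k : ℕ} (hθ : ∀ i ≤ k, P.map (z i) = θ) (hh : 0 < h) (hd : |v - ∫ x, x ∂θ| < ε) :
    P {ω | AlarmAt h (steps ε v fun i => z i ω) k} ≤ 2 / EReal.exp (root θ ε v * h) := by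
  have hint := integrable_id_of_ae_mem_Icc hs
  rw [abs_lt] at hd
  refine le_two_div_exp prob_le_one hh fun q hq₀ hq => ?_
  have hup : mgf (fun y : ℝ => y - v - ε) θ q ≤ 1 := by
    refine mgf_le_one_of_le_sInf (a := 0 - v - ε) (b := 1 - v - ε) (by fun_prop) ?_ ?_ hq₀
      (hq.trans (min_le_right _ _))
    · filter_upwards [hs] with x hx
      exact ⟨by linarith [hx.1], by linarith [hx.2]⟩
    · rw [integral_sub_sub_const hint]
      linarith
  have hlo : mgf (fun y : ℝ => v - y - ε) θ q ≤ 1 := by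
    refine mgf_le_one_of_le_sInf (a := v - 1 - ε) (b := v - 0 - ε) (by fun_prop) ?_ ?_ hq₀
      (hq.trans (min_le_left _ _))
    · filter_upwards [hs] with x hx
      exact ⟨by linarith [hx.2], by linarith [hx.1]⟩
    · rw [integral_const_sub_sub hint]
      linarith
  refine measure_alarmAt_le hh (fun i => measurable_steps measurable_const (hm i))
    (iIndepFun_steps hi) hq₀ k (fun i hik => ?_) fun i hik => ?_
  · refine lintegral_exp_le_one (a := 0 - v - ε) (b := 1 - v - ε) (hm i) (hθ i hik)
      (f := fun y => y - v - ε) (by fun_prop) ?_ hup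
    filter_upwards [hs] with x hx
    exact ⟨by linarith [hx.1], by linarith [hx.2]⟩
  · refine lintegral_exp_le_one (a := v - 1 - ε) (b := v - 0 - ε) (hm i) (hθ i hik)
      (f := fun y => v - y - ε) (by fun_prop) ?_ hlo
    filter_upwards [hs] with x hx
    exact ⟨by linarith [hx.2], by linarith [hx.1]⟩

end Samples

/-! ### Conditioning on the estimate in the change model -/

section Model

variable {Ω : Type*} [MeasurableSpace Ω] {P : Measure Ω} {y : ℕ → Ω → ℝ} {θ₀ θ₁ : Measure ℝ}
  {ν : ℕ∞} {M : ℕ} {ε h : ℝ}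

lemma IsChangeModel.measurable_tail (hy : IsChangeModel P y θ₀ θ₁ ν) (i : ℕ) :
    Measurable fun ω => tail M (path y ω) i :=
  hy.meas (M + i + 1) (by omega)

lemma IsChangeModel.iIndepFun_tail (hy : IsChangeModel P y θ₀ θ₁ ν) :
    iIndepFun (fun i ω => tail M (path y ω) i) P :=
  hy.indep.precomp (add_right_injective M)

lemma IsChangeModel.measurable_est (hy : IsChangeModel P y θ₀ θ₁ ν) : Measurable (est M y) := by
  refine (Finset.measurable_fun_sum _ fun k hk => ?_).div_const _
  exact hy.meas k (Finset.mem_Icc.1 hk).1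

lemma IsChangeModel.indepFun_est_tail (hy : IsChangeModel P y θ₀ θ₁ ν) :
    IndepFun (est M y) (fun ω => tail M (path y ω)) P := by
  refine indepFun_of_past_of_future (ξ := fun k => y (k + 1)) (k := M)
    (fun i => hy.meas (i + 1) (by omega)) hy.indep ?_ ?_
  · refine Measurable.div_const (Finset.measurable_fun_sum _ fun k hk => ?_) _
    obtain ⟨j, rfl⟩ := Nat.exists_eq_add_of_le' (Finset.mem_Icc.1 hk).1
    exact measurable_past (ξ := fun k => y (k + 1)) (Finset.mem_Icc.1 hk).2
  · refine @measurable_pi_lambda _ _ _ (future (fun k => y (k + 1)) M) _ _ fun i => ?_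
    exact measurable_future (ξ := fun k => y (k + 1)) (Nat.le_add_right M i)

lemma IsChangeModel.ae_est_mem_Icc (hy : IsChangeModel P y θ₀ θ₁ ν) (hM : 1 ≤ M)
    (hν : (M : ℕ∞) ≤ ν) : ∀ᵐ ω ∂P, est M y ω ∈ Set.Icc (0 : ℝ) 1 := by
  have hall : ∀ᵐ ω ∂P, ∀ k ∈ Finset.Icc 1 M, y k ω ∈ Set.Icc (0 : ℝ) 1 := by
    rw [Finset.eventually_all]
    intro k hk
    rw [Finset.mem_Icc] at hk
    refine ae_of_ae_map (hy.meas k hk.1).aemeasurable ?_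
    rw [hy.law_before k hk.1 (le_trans (by exact_mod_cast hk.2) hν)]
    exact hy.supp₀
  have hM' : (0 : ℝ) < M := by exact_mod_cast hM
  filter_upwards [hall] with ω hω
  refine ⟨div_nonneg (Finset.sum_nonneg fun k hk => (hω k hk).1) hM'.le, ?_⟩
  rw [est, uHat, div_le_one hM']
  refine (Finset.sum_le_card_nsmul _ _ 1 fun k hk => (hω k hk).2).trans ?_
  simp

lemma IsChangeModel.expGivenEst_eq [IsProbabilityMeasure P] (hy : IsChangeModel P y θ₀ θ₁ ν)
    {f : ℝ × (ℕ → ℝ) → ENNReal} (hf : Measurable f) :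
    expGivenEst P M y (fun ω => f (est M y ω, tail M (path y ω)))
      =ᵐ[P] fun ω => ∫⁻ ω', f (est M y ω, tail M (path y ω')) ∂P :=
  condLExp_of_indepFun hy.measurable_est (measurable_pi_lambda _ hy.measurable_tail)
    hy.indepFun_est_tail hf

lemma IsChangeModel.expGivenEst_delay [IsProbabilityMeasure P] (hy : IsChangeModel P y θ₀ θ₁ ν)
    (hh : 0 < h) (n : ℕ) :
    expGivenEst P M y (fun ω => (delay M ε h (path y ω) (M + n) : ENNReal))
      =ᵐ[P] fun ω => ∫⁻ ω', waitTime h (steps ε (est M y ω) (tail M (path y ω'))) n ∂P := by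
  simp only [delay_eq_waitTime hh]
  exact hy.expGivenEst_eq (f := fun p => waitTime h (steps ε p.1 p.2) n)
    (measurable_waitTime (σ := fun i (p : ℝ × (ℕ → ℝ)) => steps ε p.1 p.2 i)
      (fun i => measurable_steps (x := fun i (p : ℝ × (ℕ → ℝ)) => p.2 i) measurable_fst
        (by fun_prop)) n)

lemma IsChangeModel.expGivenEst_falseAlarms_le [IsProbabilityMeasure P]
    (hy : IsChangeModel P y θ₀ θ₁ ν) (hh : 0 < h) (T : ℕ) :
    expGivenEst P M y (fun ω => (falseAlarms M ε h (path y ω) ν T : ENNReal))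
      ≤ᵐ[P] fun ω => ∑ k ∈ Finset.range T, if ((M + k + 1 : ℕ) : ℕ∞) ≤ ν then
        P {ω' | AlarmAt h (steps ε (est M y ω) (tail M (path y ω'))) k} else 0 := by
  classical
  have hA : ∀ k, MeasurableSet {p : ℝ × (ℕ → ℝ) | AlarmAt h (steps ε p.1 p.2) k} := fun k =>
    measurableSet_alarmAt (σ := fun i (p : ℝ × (ℕ → ℝ)) => steps ε p.1 p.2 i)
      fun i _ => measurable_steps (x := fun i (p : ℝ × (ℕ → ℝ)) => p.2 i) measurable_fst
        (by fun_prop)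
  have hterm : ∀ k, Measurable fun p : ℝ × (ℕ → ℝ) =>
      if ((M + k + 1 : ℕ) : ℕ∞) ≤ ν ∧ AlarmAt h (steps ε p.1 p.2) k then (1 : ENNReal) else 0 :=
    fun k => Measurable.ite ((MeasurableSet.const _).inter (hA k)) measurable_const
      measurable_const
  simp only [falseAlarms_eq_sum hh]
  refine (hy.expGivenEst_eq (M := M) (f := fun p => ∑ k ∈ Finset.range T,
    if ((M + k + 1 : ℕ) : ℕ∞) ≤ ν ∧ AlarmAt h (steps ε p.1 p.2) k then 1 else 0)
    (Finset.measurable_fun_sum _ fun k _ => hterm k)).le.trans (ae_of_all _ fun ω => ?_)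
  have htail : Measurable fun ω' => (est M y ω, tail M (path y ω')) :=
    measurable_const.prodMk (measurable_pi_lambda _ hy.measurable_tail)
  refine (lintegral_finsetSum _ fun k _ => (hterm k).comp htail).le.trans ?_
  refine Finset.sum_le_sum fun k _ => ?_
  split_ifs with hk
  · simp only [Function.comp_def, hk, true_and]
    exact (lintegral_indicator_one (htail (hA k))).le
  · simp only [Function.comp_def, hk, false_and, if_false, lintegral_zero, le_refl]

end Model

end

end TailoredCUSUM

theorem proposition1 {Ω : Type*} [MeasurableSpace Ω] (P : Measure Ω) [IsProbabilityMeasure P]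
    (y : ℕ → Ω → ℝ) (θ₀ θ₁ : Measure ℝ) [IsProbabilityMeasure θ₀] [IsProbabilityMeasure θ₁]
    (ν : ℕ∞) (hy : TailoredCUSUM.IsChangeModel P y θ₀ θ₁ ν)
    (M : ℕ) (hM : 1 ≤ M) (ε h : ℝ) (hε : 0 < ε) (hh : 0 < h)
    (u₀ u₁ : ℝ) (hu₀ : u₀ = ∫ x, x ∂θ₀) (hu₁ : u₁ = ∫ x, x ∂θ₁)
    -- the first `M` samples precede the change
    (hν : (M : ℕ∞) ≤ ν)
    -- if there is a change, the mean moves by at least `3ε`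
    (hdetect : ν ≠ ⊤ → 3 * ε ≤ |u₀ - u₁|) :
    -- expected detection delay
    (∀ n : ℕ, ν = n → ∀ᵐ ω ∂P, |TailoredCUSUM.est M y ω - u₀| < ε →
      TailoredCUSUM.expGivenEst P M y
          (fun ω' => (TailoredCUSUM.delay M ε h (TailoredCUSUM.path y ω') n : ENNReal)) ω
        ≤ ENNReal.ofReal ((h + 1) / (|u₁ - TailoredCUSUM.est M y ω| - ε))) ∧
    -- expected number of false alarms
    (∀ T : ℕ, ∀ᵐ ω ∂P, |TailoredCUSUM.est M y ω - u₀| < ε →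
      TailoredCUSUM.expGivenEst P M y
          (fun ω' => (TailoredCUSUM.falseAlarms M ε h (TailoredCUSUM.path y ω') ν T : ENNReal)) ω
        ≤ 2 * T / EReal.exp (TailoredCUSUM.root θ₀ ε (TailoredCUSUM.est M y ω) * h)) ∧
    -- the same bound for the horizon divided by the mean time between false alarms
    (ν = ⊤ → ∀ T : ℕ, ∀ᵐ ω ∂P, |TailoredCUSUM.est M y ω - u₀| < ε →
      (T : ENNReal) / TailoredCUSUM.expGivenEst P M y
          (fun ω' => (TailoredCUSUM.runLength M ε h (TailoredCUSUM.path y ω') : ENNReal)) ω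
        ≤ 2 * T / EReal.exp (TailoredCUSUM.root θ₀ ε (TailoredCUSUM.est M y ω) * h)) ∧
    -- expected time until a restart when the estimate is bad
    (ν = ⊤ → ∀ᵐ ω ∂P, ε < |TailoredCUSUM.est M y ω - u₀| →
      TailoredCUSUM.expGivenEst P M y
          (fun ω' => (TailoredCUSUM.runLength M ε h (TailoredCUSUM.path y ω') : ENNReal)) ω
        ≤ ENNReal.ofReal ((h + 1) / (|TailoredCUSUM.est M y ω - u₀| - ε))) := by
  subst hu₀ hu₁
  have hm := fun i => hy.measurable_tail (M := M) i
  have hi := hy.iIndepFun_tail (M := M)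
  have hmul : ∀ (T : ℕ) (e : ENNReal), 2 * (T : ENNReal) / e = T * (2 / e) := fun T e => by
    rw [← mul_div_assoc, mul_comm]
  have hrun : TailoredCUSUM.expGivenEst P M y
        (fun ω => (TailoredCUSUM.runLength M ε h (TailoredCUSUM.path y ω) : ENNReal))
      =ᵐ[P] fun ω => ∫⁻ ω', TailoredCUSUM.waitTime h (TailoredCUSUM.steps ε
        (TailoredCUSUM.est M y ω) (TailoredCUSUM.tail M (TailoredCUSUM.path y ω'))) 0 ∂P :=
    hy.expGivenEst_delay (ε := ε) hh 0
  refine ⟨fun n hn => ?_, fun T => ?_, fun htop T => ?_, fun htop => ?_⟩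
  · obtain ⟨d, rfl⟩ : ∃ d, n = M + d :=
      Nat.exists_eq_add_of_le (by rw [hn] at hν; exact_mod_cast hν)
    have h3 := hdetect (by rw [hn]; exact ENat.natCast_ne_top _)
    filter_upwards [hy.expGivenEst_delay (M := M) (ε := ε) hh d, hy.ae_est_mem_Icc hM hν]
      with ω hω hv hd
    rw [hω]
    refine TailoredCUSUM.lintegral_waitTime_steps_le hy.supp₁ hm hi (fun i hi => ?_) hh hε hv ?_
    · refine hy.law_after (M + i + 1) (by omega) ?_
      rw [hn]
      exact_mod_cast (by omega : M + d < M + i + 1)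
    -- The estimate is within `ε` of `u₀`, so it is more than `3ε - ε = 2ε` away from `u₁`.
    · have := abs_sub_le (∫ x, x ∂θ₀) (TailoredCUSUM.est M y ω) (∫ x, x ∂θ₁)
      rw [abs_sub_comm] at hd
      rw [abs_sub_comm]
      linarith
  · filter_upwards [hy.expGivenEst_falseAlarms_le (M := M) (ε := ε) hh T] with ω hω hd
    refine hω.trans ?_
    rw [hmul]
    refine (Finset.sum_le_card_nsmul _ _
      (2 / EReal.exp (TailoredCUSUM.root θ₀ ε (TailoredCUSUM.est M y ω) * h)) fun k _ => ?_).trans (le_of_eq ?_)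
    -- Slots after the change contribute nothing; at any other slot all samples so far have law
    -- `θ₀`.
    · split_ifs with hk
      · refine TailoredCUSUM.measure_alarmAt_steps_le hy.supp₀ hm hi (fun i hik => ?_) hh hd
        refine hy.law_before (M + i + 1) (by omega) (le_trans ?_ hk)
        exact_mod_cast (by omega : M + i + 1 ≤ M + k + 1)
      · exact zero_le
    · simp
  · filter_upwards [hrun] with ω hω hd
    rw [hω, hmul, div_eq_mul_inv]
    gcongr
    rw [ENNReal.inv_le_iff_inv_le]
    have hlaw : ∀ i, P.map (fun ω => TailoredCUSUM.tail M (TailoredCUSUM.path y ω) i) = θ₀ :=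
      fun i => hy.law_before (M + i + 1) (by omega) (by rw [htop]; exact le_top)
    exact TailoredCUSUM.inv_le_lintegral_waitTime
      (fun i => TailoredCUSUM.measurable_steps measurable_const (hm i))
      (TailoredCUSUM.iIndepFun_steps hi) (fun i => TailoredCUSUM.map_steps hm (hlaw i))
      fun k => TailoredCUSUM.measure_alarmAt_steps_le hy.supp₀ hm hi (fun i _ => hlaw i) hh hd
  · filter_upwards [hrun, hy.ae_est_mem_Icc hM hν] with ω hω hv hd
    rw [hω]
    rw [abs_sub_comm] at hd ⊢
    exact TailoredCUSUM.lintegral_waitTime_steps_le hy.supp₀ hm hi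
      (fun i _ => hy.law_before (M + i + 1) (by omega) (by rw [htop]; exact le_top)) hh hε hv hd
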